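/- Let $n\ge 1$, $s\in(0,1)$, $1<p^-<p^+<\infty$ with $sp^+<n$, let $\mu>0$ and $\lambda\in\mathbb R$. There is a constant $C_0=C_0(n,s,p^\pm,\mu,\lambda)>0$ with the following property. Let $G(t)=\int_0^t g(\tau)\,d\tau$, $t\ge 0$, be a Young function, i.e. $g:[0,\infty)\to[0,\infty)$ is right-continuous and nondecreasing, $g(0)=0$, $g(t)>0$ for $t>0$ and $g(t)\to\infty$ as $t\to\infty$; extend $G$ evenly and $g$ oddly to $\mathbb R$. Assume the normalization $G(1)=1$ and $$p^-\le \frac{t\,g(t)}{G(t)}\le p^+\qquad\text{for all } t>0 .$$ Let $\Omega\subset\mathbb R^n$ be a bounded open set, and let $W^{s,G}_0(\Omega)$ be the set of measurable $u:\mathbb R^n\to\mathbb R$ with $u=0$ a.e. in $\mathbb R^n\setminus\Omega$, $$\int_\Omega G(|u|)\,dx<\infty\quad\text{and}\quad \iint_{\mathbb R^n\times\mathbb R^n}G\Big(\frac{|u(x)-u(y)|}{|x-y|^s}\Big)\frac{dx\,dy}{|x-y|^n}<\infty .$$ If $u\in W^{s,G}_0(\Omega)$ is a weak solution of $(-\Delta_g)^su=\lambda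 g(u)$ in $\Omega$, $u=0$ in $\mathbb R^n\setminus\Omega$, that is, $$\iint_{\mathbb R^n\times\mathbb R^n} g\Big(\frac{u(x)-u(y)}{|x-y|^s}\Big)\frac{v(x)-v(y)}{|x-y|^{n+s}}\,dx\,dy=\lambda\int_\Omega g(u)\,v\,dx\qquad\text{for all } v\in W^{s,G}_0(\Omega),$$ and if $\int_\Omega G(|u|)\,dx=\mu$, then $u$ is bounded in $\Omega$ (i.e. $u\in L^\infty(\Omega)$) and $$\|u\|_{L^\infty(\Omega)}\le C_0 .$$ -/

import Mathlib

open MeasureTheory Set Filter Topology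
open scoped ENNReal

noncomputable section

namespace FracOrlicz

/-- `G` is a Young function with density `g`: on `[0,∞)` one has `G t = ∫₀ᵗ g`, where `g` is
right-continuous, vanishes at `0`, is positive on `(0,∞)`, nondecreasing and tends to infinity.
`G` is extended to negative arguments as an even function, and correspondingly `g = G'` as an odd
function. -/
structure IsYoungFunction (G g : ℝ → ℝ) : Prop where
  density_zero : g 0 = 0
  density_pos : ∀ t, 0 < t → 0 < g t
  density_mono : MonotoneOn g (Ioi 0)
  density_right_cont : ∀ t, 0 ≤ t → ContinuousWithinAt g (Ici t) t
  density_tendsto : Tendsto g atTop atTop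
  density_odd : ∀ t, g (-t) = -g t
  eq_integral : ∀ t, 0 ≤ t → G t = ∫ τ in (0 : ℝ)..t, g τ
  even : ∀ t, G (-t) = G t

variable {n : ℕ}

/-- The `s`-Hölder quotient `D_s u (x, y) = (u x - u y) / |x - y|^s`. -/
def holderQuot (s : ℝ) (u : EuclideanSpace ℝ (Fin n) → ℝ)
    (x y : EuclideanSpace ℝ (Fin n)) : ℝ :=
  (u x - u y) / ‖x - y‖ ^ s

/-- The modular `Φ_G u = ∫_Ω G(|u|) dx`, with values in `[0,∞]`. -/
def modular (G : ℝ → ℝ) (Ω : Set (EuclideanSpace ℝ (Fin n)))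
    (u : EuclideanSpace ℝ (Fin n) → ℝ) : ℝ≥0∞ :=
  ∫⁻ x in Ω, ENNReal.ofReal (G |u x|)

/-- The fractional modular `Φ_{s,G} u = ∬ G(|D_s u|) dx dy / |x - y|^n` over `ℝⁿ × ℝⁿ`,
with values in `[0,∞]`. -/
def fracModular (s : ℝ) (G : ℝ → ℝ) (u : EuclideanSpace ℝ (Fin n) → ℝ) : ℝ≥0∞ :=
  ∫⁻ p : EuclideanSpace ℝ (Fin n) × EuclideanSpace ℝ (Fin n),
    ENNReal.ofReal (G |holderQuot s u p.1 p.2| / ‖p.1 - p.2‖ ^ n)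

/-- `u ∈ W^{s,G}(Ω)`: `u : ℝⁿ → ℝ` is (Lebesgue) measurable and both modulars are finite. -/
structure MemW (s : ℝ) (G : ℝ → ℝ) (Ω : Set (EuclideanSpace ℝ (Fin n)))
    (u : EuclideanSpace ℝ (Fin n) → ℝ) : Prop where
  aemeasurable : AEMeasurable u volume
  modular_lt_top : modular G Ω u < ⊤
  fracModular_lt_top : fracModular s G u < ⊤

/-- `u ∈ W^{s,G}_0(Ω)`: `u ∈ W^{s,G}(Ω)` and `u = 0` a.e. in `ℝⁿ \ Ω`. -/
structure MemW0 (s : ℝ) (G : ℝ → ℝ) (Ω : Set (EuclideanSpace ℝ (Fin n)))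
    (u : EuclideanSpace ℝ (Fin n) → ℝ) : Prop extends MemW s G Ω u where
  ae_eq_zero : ∀ᵐ x ∂volume, x ∉ Ω → u x = 0

/-- The pairing
`⟨(-Δ_g)^s u, v⟩ = ∬ g((u x - u y) / |x - y|^s) (v x - v y) / |x - y|^(n+s) dx dy`. -/
def fracLaplacePairing (s : ℝ) (g : ℝ → ℝ) (u v : EuclideanSpace ℝ (Fin n) → ℝ) : ℝ :=
  ∫ p : EuclideanSpace ℝ (Fin n) × EuclideanSpace ℝ (Fin n),
    g (holderQuot s u p.1 p.2) * ((v p.1 - v p.2) / ‖p.1 - p.2‖ ^ ((n : ℝ) + s))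

/-- `u ∈ W^{s,G}_0(Ω)` is a weak solution of `(-Δ_g)^s u = lam * g(u)` in `Ω`, `u = 0` in
`ℝⁿ \ Ω`. For `u, v ∈ W^{s,G}_0(Ω)` and `G` doubling with doubling conjugate, both integrands
are integrable by Young's inequality. -/
structure IsWeakSolution (s : ℝ) (G g : ℝ → ℝ) (lam : ℝ)
    (Ω : Set (EuclideanSpace ℝ (Fin n))) (u : EuclideanSpace ℝ (Fin n) → ℝ) : Prop where
  memW0 : MemW0 s G Ω u
  weak_eq : ∀ v : EuclideanSpace ℝ (Fin n) → ℝ, MemW0 s G Ω v →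
    fracLaplacePairing s g u v = lam * ∫ x in Ω, g (u x) * v x

end FracOrlicz

end

/-! The proof is a De Giorgi iteration in which a modular Faber–Krahn inequality plays the role of a
Sobolev embedding. If the support of `v` fills at most half the volume of a ball of radius `r ≤ 1`,
then around each `x` with `v x ≠ 0` at least half of that ball consists of points where `v`
vanishes. Integrating the Hölder quotient over them gives `∫ G(|v|) ≤ C r^s Φ_{s,G}(v)`
(`lintegral_le_mul_fracModular`).

Testing the equation with `(u - l)⁺` bounds its fractional modular by `|λ| p m^p ∫ G((u - k)⁺)`,
where `l ≤ m (l - k)` (`IsWeakSolution.fracModular_excess_le`). Chebyshev's inequality makes the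
support of `(u - l)⁺` small. Along the levels `K(1 - 2^{-j})` the factor `m^p` grows like `2^{jp}`.
Radii `ρ q^j` with `q^s 2^p = 1` cancel this growth, so the modulars decay geometrically and `u ≤ K`
a.e. Applying this to `-u` gives the lower bound. -/

noncomputable section

namespace FracOrlicz

/-! ### Young functions: convexity and growth. -/

namespace IsYoungFunction

variable {G g : ℝ → ℝ}

theorem density_nonneg (h : IsYoungFunction G g) {t : ℝ} (ht : 0 ≤ t) : 0 ≤ g t := by
  rcases ht.eq_or_lt with rfl | ht
  · exact h.density_zero.ge
  · exact (h.density_pos t ht).le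

theorem density_monotone (h : IsYoungFunction G g) : Monotone g := by
  have key : ∀ a b, 0 ≤ a → a ≤ b → g a ≤ g b := by
    intro a b ha hab
    rcases ha.eq_or_lt with rfl | ha
    · rw [h.density_zero]; exact h.density_nonneg hab
    · exact h.density_mono ha (ha.trans_le hab) hab
  intro a b hab
  rcases le_total 0 a with ha | ha
  · exact key a b ha hab
  rcases le_total 0 b with hb | hb
  · have := h.density_nonneg (neg_nonneg.2 ha)
    rw [h.density_odd] at this
    linarith [h.density_nonneg hb]
  · have := key (-b) (-a) (by linarith) (by linarith)
    rw [h.density_odd, h.density_odd] at this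
    linarith

theorem density_abs_mul_abs (h : IsYoungFunction G g) (t : ℝ) : g |t| * |t| = g t * t := by
  rcases abs_cases t with ⟨ht, -⟩ | ⟨ht, -⟩ <;> rw [ht]
  rw [h.density_odd]; ring

theorem measurable_density (h : IsYoungFunction G g) : Measurable g :=
  h.density_monotone.measurable

theorem intervalIntegrable (h : IsYoungFunction G g) (a b : ℝ) :
    IntervalIntegrable g volume a b :=
  h.density_monotone.intervalIntegrable

theorem continuous_comp_abs (h : IsYoungFunction G g) : Continuous fun t => G |t| := by
  have : (fun t => G |t|) = (fun t => ∫ τ in (0 : ℝ)..t, g τ) ∘ abs := by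
    ext t; exact h.eq_integral _ (abs_nonneg t)
  rw [this]
  exact (intervalIntegral.continuous_primitive h.intervalIntegrable 0).comp continuous_abs

theorem continuousOn (h : IsYoungFunction G g) : ContinuousOn G (Ici 0) :=
  h.continuous_comp_abs.continuousOn.congr fun t (ht : 0 ≤ t) => by
    simp only [abs_of_nonneg ht]

/-- The density may jump, so only right derivatives are available; the comparisons below rely on
them. -/
theorem hasDerivWithinAt (h : IsYoungFunction G g) {t : ℝ} (ht : 0 ≤ t) :
    HasDerivWithinAt G (g t) (Ici t) t := by
  have : HasDerivWithinAt (fun t => ∫ τ in (0 : ℝ)..t, g τ) (g t) (Ici t) t :=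
    intervalIntegral.integral_hasDerivWithinAt_right (h.intervalIntegrable 0 t)
      (h.measurable_density.stronglyMeasurable.stronglyMeasurableAtFilter)
      ((h.density_right_cont t ht).mono Ioi_subset_Ici_self)
  exact this.congr (fun x hx => h.eq_integral x (ht.trans hx)) (h.eq_integral t ht)

theorem map_zero (h : IsYoungFunction G g) : G 0 = 0 := by
  rw [h.eq_integral 0 le_rfl, intervalIntegral.integral_same]

theorem mono (h : IsYoungFunction G g) {a b : ℝ} (ha : 0 ≤ a) (hab : a ≤ b) : G a ≤ G b := by
  have hadd := intervalIntegral.integral_add_adjacent_intervals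
    (h.intervalIntegrable 0 a) (h.intervalIntegrable a b)
  have hnn : 0 ≤ ∫ τ in a..b, g τ :=
    intervalIntegral.integral_nonneg hab fun τ hτ => h.density_nonneg (ha.trans hτ.1)
  rw [h.eq_integral a ha, h.eq_integral b (ha.trans hab)]
  linarith

theorem nonneg (h : IsYoungFunction G g) {t : ℝ} (ht : 0 ≤ t) : 0 ≤ G t := by
  rw [← h.map_zero]; exact h.mono le_rfl ht

theorem le_mul_density (h : IsYoungFunction G g) {t : ℝ} (ht : 0 ≤ t) : G t ≤ t * g t := by
  rw [h.eq_integral t ht]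
  have := intervalIntegral.integral_mono_on ht (h.intervalIntegrable 0 t)
    (intervalIntegrable_const (c := g t)) fun x hx => h.density_monotone hx.2
  simpa using this

theorem abs_le_density_mul_self (h : IsYoungFunction G g) (t : ℝ) : G |t| ≤ g t * t := by
  rw [← h.density_abs_mul_abs, mul_comm]
  exact h.le_mul_density (abs_nonneg t)

theorem pos (h : IsYoungFunction G g) {t : ℝ} (ht : 0 < t) : 0 < G t := by
  rw [h.eq_integral t ht.le]
  exact intervalIntegral.intervalIntegral_pos_of_pos_on (h.intervalIntegrable 0 t)
    (fun x hx => h.density_pos x hx.1) ht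

/-- The chord from the origin to `(t, G t)` has slope at most `g t`, hence at most `g x` for `x ≥
t`, so `G` stays above its extension. -/
theorem mul_le_comp_mul (h : IsYoungFunction G g) {c t : ℝ} (hc : 1 ≤ c) (ht : 0 ≤ t) :
    c * G t ≤ G (c * t) := by
  rcases ht.eq_or_lt with rfl | ht
  · simp [h.map_zero]
  have hct : t ≤ c * t := le_mul_of_one_le_left ht.le hc
  have := image_le_of_deriv_right_le_deriv_boundary (f := fun x => G t / t * x)
    (f' := fun _ => G t / t) (a := t) (b := c * t) (by fun_prop)
    (fun x _ => by simpa using ((hasDerivAt_id x).const_mul (G t / t)).hasDerivWithinAt)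
    (B := G) (B' := g) (by simp [ht.ne'])
    (h.continuousOn.mono fun x hx => ht.le.trans hx.1)
    (fun x hx => h.hasDerivWithinAt (ht.le.trans hx.1))
    (fun x hx => by
      rw [div_le_iff₀ ht, mul_comm]
      exact (h.le_mul_density ht.le).trans
        (mul_le_mul_of_nonneg_left (h.density_monotone hx.1) ht.le))
    (right_mem_Icc.2 hct)
  calc c * G t = G t / t * (c * t) := by field_simp
    _ ≤ _ := this

/-- The growth condition says exactly that `G x * x ^ (-p)` has nonpositive right derivative. -/
theorem comp_mul_le (h : IsYoungFunction G g) {p : ℝ}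
    (hp : ∀ t, 0 < t → t * g t ≤ p * G t) {c t : ℝ} (hc : 1 ≤ c) (ht : 0 ≤ t) :
    G (c * t) ≤ c ^ p * G t := by
  rcases ht.eq_or_lt with rfl | ht
  · simp [h.map_zero]
  have hct : t ≤ c * t := le_mul_of_one_le_left ht.le hc
  have hc0 : 0 < c := by linarith
  have := image_le_of_deriv_right_le_deriv_boundary (f := fun x => G x * x ^ (-p))
    (f' := fun x => g x * x ^ (-p) + G x * (-p * x ^ (-p - 1))) (a := t) (b := c * t)
    ((h.continuousOn.mono fun x hx => ht.le.trans hx.1).mul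
      (continuousOn_id.rpow_const fun x hx => Or.inl (ht.trans_le hx.1).ne'))
    (fun x hx => (h.hasDerivWithinAt (ht.le.trans hx.1)).mul
      (Real.hasDerivAt_rpow_const (Or.inl (ht.trans_le hx.1).ne')).hasDerivWithinAt)
    (B := fun _ => G t * t ^ (-p)) (B' := fun _ => 0) le_rfl continuousOn_const
    (fun x _ => (hasDerivAt_const x _).hasDerivWithinAt)
    (fun x hx => by
      have hx0 : 0 < x := ht.trans_le hx.1
      have e : x ^ (-p) = x ^ (-p - 1) * x := by
        rw [Real.rpow_sub_one hx0.ne']; field_simp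
      rw [e]
      nlinarith [hp x hx0, Real.rpow_pos_of_pos hx0 (-p - 1)])
    (right_mem_Icc.2 hct)
  simp only [Real.mul_rpow hc0.le ht.le, Real.rpow_neg hc0.le] at this
  have htp := Real.rpow_pos_of_pos ht (-p)
  have hcp := Real.rpow_pos_of_pos hc0 p
  rw [← mul_assoc] at this
  have := le_of_mul_le_mul_right this htp
  rwa [← div_eq_mul_inv, div_le_iff₀ hcp, mul_comm (G t)] at this

theorem density_mul_self_le (h : IsYoungFunction G g) {p : ℝ}
    (hp : ∀ t, 0 < t → t * g t ≤ p * G t) (t : ℝ) : g t * t ≤ p * G |t| := by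
  rcases eq_or_ne t 0 with rfl | ht
  · simp [h.map_zero]
  rw [← h.density_abs_mul_abs, mul_comm]
  exact hp _ (abs_pos.2 ht)

end IsYoungFunction

/-! ### The modular Faber–Krahn inequality. -/

variable {n : ℕ} {s : ℝ} {G g : ℝ → ℝ} {u v : EuclideanSpace ℝ (Fin n) → ℝ}
  {Ω : Set (EuclideanSpace ℝ (Fin n))}

/-- The volume of the unit ball of `ℝⁿ`. -/
def unitBallVolume (n : ℕ) : ℝ :=
  (volume (Metric.ball (0 : EuclideanSpace ℝ (Fin n)) 1)).toReal

theorem unitBallVolume_pos (n : ℕ) : 0 < unitBallVolume n :=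
  ENNReal.toReal_pos (Metric.measure_ball_pos volume _ one_pos).ne' measure_ball_lt_top.ne

theorem volume_ball_eq (x : EuclideanSpace ℝ (Fin n)) {r : ℝ} (hr : 0 < r) :
    volume (Metric.ball x r) = ENNReal.ofReal (unitBallVolume n * r ^ n) := by
  rw [Measure.addHaar_ball_of_pos _ _ hr, finrank_euclideanSpace_fin, unitBallVolume,
    ENNReal.ofReal_mul ENNReal.toReal_nonneg, ENNReal.ofReal_toReal measure_ball_lt_top.ne,
    mul_comm]

theorem aemeasurable_holderQuot (s : ℝ) (hu : AEMeasurable u volume) :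
    AEMeasurable (fun p : EuclideanSpace ℝ (Fin n) × EuclideanSpace ℝ (Fin n) =>
      holderQuot s u p.1 p.2) volume := by
  have h1 : AEMeasurable (fun p : EuclideanSpace ℝ (Fin n) × EuclideanSpace ℝ (Fin n) => u p.1)
    volume := hu.comp_fst
  have h2 : AEMeasurable (fun p : EuclideanSpace ℝ (Fin n) × EuclideanSpace ℝ (Fin n) => u p.2)
    volume := hu.comp_snd
  have h3 : Measurable fun p : EuclideanSpace ℝ (Fin n) × EuclideanSpace ℝ (Fin n) =>
    ‖p.1 - p.2‖ ^ s := by fun_prop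
  exact (h1.sub h2).div h3.aemeasurable

theorem aemeasurable_fracModular_integrand (h : IsYoungFunction G g) (s : ℝ)
    (hu : AEMeasurable u volume) :
    AEMeasurable (fun p : EuclideanSpace ℝ (Fin n) × EuclideanSpace ℝ (Fin n) =>
      ENNReal.ofReal (G |holderQuot s u p.1 p.2| / ‖p.1 - p.2‖ ^ n)) volume := by
  have h1 := h.continuous_comp_abs.measurable.comp_aemeasurable (aemeasurable_holderQuot s hu)
  have h2 : Measurable fun p : EuclideanSpace ℝ (Fin n) × EuclideanSpace ℝ (Fin n) =>
    ‖p.1 - p.2‖ ^ n := by fun_prop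
  exact (h1.div h2.aemeasurable).ennreal_ofReal

/-- A lower bound for the inner integral of the fractional modular at a point, when the
function is supported in a set of measure at most half of that of a ball of radius `r`. -/
theorem le_lintegral_of_volume_ne_zero_le (h : IsYoungFunction G g) (hs0 : 0 < s)
    (hv : AEMeasurable v volume) {r : ℝ} (hr0 : 0 < r) (hr1 : r ≤ 1)
    (hvol : volume {x | v x ≠ 0} ≤ ENNReal.ofReal (unitBallVolume n * r ^ n / 2))
    (x : EuclideanSpace ℝ (Fin n)) :
    ENNReal.ofReal (unitBallVolume n / 2 / r ^ s) * ENNReal.ofReal (G |v x|) ≤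
      ∫⁻ y, ENNReal.ofReal (G |holderQuot s v x y| / ‖x - y‖ ^ n) := by
  have hω := unitBallVolume_pos n
  have hrs : 0 < r ^ s := Real.rpow_pos_of_pos hr0 s
  have hrs1 : r ^ s ≤ 1 := Real.rpow_le_one hr0.le hr1 hs0.le
  rcases eq_or_ne (v x) 0 with hx | hx
  · simp [hx, h.map_zero]
  have hGx : 0 ≤ G |v x| := h.nonneg (abs_nonneg _)
  -- A pointwise lower bound for the integrand at the points `y` of the ball where `v y = 0`.
  set c : ℝ := G |v x| / r ^ s / r ^ n with hc
  have hc0 : 0 ≤ c := by positivity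
  have hmeas : AEMeasurable
      (fun y => ENNReal.ofReal (G |holderQuot s v x y| / ‖x - y‖ ^ n)) volume := by
    have h1 : AEMeasurable (fun y => holderQuot s v x y) volume := by
      have h3 : Measurable fun y : EuclideanSpace ℝ (Fin n) => ‖x - y‖ ^ s := by fun_prop
      exact (aemeasurable_const.sub hv).div h3.aemeasurable
    have h2 : Measurable fun y : EuclideanSpace ℝ (Fin n) => ‖x - y‖ ^ n := by fun_prop
    exact ((h.continuous_comp_abs.measurable.comp_aemeasurable h1).div
      h2.aemeasurable).ennreal_ofReal
  have hsub : Metric.ball x r \ {x | v x ≠ 0} ⊆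
      {y | ENNReal.ofReal c ≤ ENNReal.ofReal (G |holderQuot s v x y| / ‖x - y‖ ^ n)} := by
    rintro y ⟨hy, hvy⟩
    have hvy : v y = 0 := by simpa using hvy
    have hxy : x ≠ y := by rintro rfl; exact hx hvy
    have hd : 0 < ‖x - y‖ := norm_pos_iff.2 (sub_ne_zero.2 hxy)
    have hdr : ‖x - y‖ ≤ r := by
      rw [Metric.mem_ball, dist_comm, dist_eq_norm] at hy; exact hy.le
    have hds : 0 < ‖x - y‖ ^ s := Real.rpow_pos_of_pos hd s
    have hdsr : ‖x - y‖ ^ s ≤ r ^ s := Real.rpow_le_rpow hd.le hdr hs0.le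
    apply ENNReal.ofReal_le_ofReal
    -- The gain `1 / r ^ s` comes out of `G` by superlinearity, which needs `r ≤ 1`.
    have h1 : G |v x| / r ^ s ≤ G |holderQuot s v x y| := by
      calc G |v x| / r ^ s = 1 / r ^ s * G |v x| := by ring
        _ ≤ G (1 / r ^ s * |v x|) :=
          h.mul_le_comp_mul ((one_le_div hrs).2 hrs1) (abs_nonneg _)
        _ ≤ G |holderQuot s v x y| := by
          apply h.mono (by positivity)
          rw [holderQuot, hvy, sub_zero, abs_div, abs_of_pos hds, one_div_mul_eq_div]
          gcongr
    have h2 : 0 ≤ G |holderQuot s v x y| := h.nonneg (abs_nonneg _)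
    rw [hc]
    gcongr
  calc ENNReal.ofReal (unitBallVolume n / 2 / r ^ s) * ENNReal.ofReal (G |v x|)
      = ENNReal.ofReal c * ENNReal.ofReal (unitBallVolume n * r ^ n / 2) := by
        rw [← ENNReal.ofReal_mul (by positivity), ← ENNReal.ofReal_mul hc0, hc]
        congr 1
        field_simp
    _ ≤ ENNReal.ofReal c * volume (Metric.ball x r \ {x | v x ≠ 0}) := by
        gcongr
        refine le_trans ?_ le_measure_sdiff
        rw [volume_ball_eq x hr0]
        refine le_trans ?_ (tsub_le_tsub_left hvol _)
        rw [← ENNReal.ofReal_sub _ (by positivity)]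
        apply ENNReal.ofReal_le_ofReal
        linarith
    _ ≤ ENNReal.ofReal c *
        volume {y | ENNReal.ofReal c ≤
          ENNReal.ofReal (G |holderQuot s v x y| / ‖x - y‖ ^ n)} := by
        gcongr
    _ ≤ _ := mul_meas_ge_le_lintegral₀ hmeas _

/-- A modular Faber–Krahn inequality: the modular of a function with small support is controlled
by its fractional modular. -/
theorem lintegral_le_mul_fracModular (h : IsYoungFunction G g) (hs0 : 0 < s)
    (hv : AEMeasurable v volume) {r : ℝ} (hr0 : 0 < r) (hr1 : r ≤ 1)
    (hvol : volume {x | v x ≠ 0} ≤ ENNReal.ofReal (unitBallVolume n * r ^ n / 2)) :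
    ∫⁻ x, ENNReal.ofReal (G |v x|) ≤
      ENNReal.ofReal (2 * r ^ s / unitBallVolume n) * fracModular s G v := by
  have hω := unitBallVolume_pos n
  have hrs : 0 < r ^ s := Real.rpow_pos_of_pos hr0 s
  have hmeas : AEMeasurable (fun x => ENNReal.ofReal (G |v x|)) volume :=
    (h.continuous_comp_abs.measurable.comp_aemeasurable hv).ennreal_ofReal
  have key : ENNReal.ofReal (unitBallVolume n / 2 / r ^ s) * ∫⁻ x, ENNReal.ofReal (G |v x|) ≤
      fracModular s G v := by
    rw [← lintegral_const_mul'' _ hmeas, fracModular, Measure.volume_eq_prod,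
      lintegral_prod _ (aemeasurable_fracModular_integrand h s hv)]
    exact lintegral_mono fun x => le_lintegral_of_volume_ne_zero_le h hs0 hv hr0 hr1 hvol x
  calc ∫⁻ x, ENNReal.ofReal (G |v x|)
      = ENNReal.ofReal (2 * r ^ s / unitBallVolume n) *
        (ENNReal.ofReal (unitBallVolume n / 2 / r ^ s) * ∫⁻ x, ENNReal.ofReal (G |v x|)) := by
        rw [← mul_assoc, ← ENNReal.ofReal_mul (by positivity)]
        have : 2 * r ^ s / unitBallVolume n * (unitBallVolume n / 2 / r ^ s) = 1 := by
          field_simp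
        rw [this, ENNReal.ofReal_one, one_mul]
    _ ≤ _ := by gcongr

/-! ### Truncation above a level. -/

/-- The part of `u` above the level `k`. -/
def excess (u : EuclideanSpace ℝ (Fin n) → ℝ) (k : ℝ) (x : EuclideanSpace ℝ (Fin n)) : ℝ :=
  max (u x - k) 0

theorem excess_nonneg (u : EuclideanSpace ℝ (Fin n) → ℝ) (k : ℝ)
    (x : EuclideanSpace ℝ (Fin n)) : 0 ≤ excess u k x :=
  le_max_right _ _

theorem excess_le_abs (u : EuclideanSpace ℝ (Fin n) → ℝ) {k : ℝ} (hk : 0 ≤ k)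
    (x : EuclideanSpace ℝ (Fin n)) : excess u k x ≤ |u x| :=
  max_le ((sub_le_self _ hk).trans (le_abs_self _)) (abs_nonneg _)

/-- Truncation is nondecreasing and 1-Lipschitz. The signs are kept so that the monotonicity of `g`
can be applied to the two quotients. -/
theorem holderQuot_excess (u : EuclideanSpace ℝ (Fin n) → ℝ) (k : ℝ)
    (x y : EuclideanSpace ℝ (Fin n)) :
    (0 ≤ holderQuot s (excess u k) x y ∧
        holderQuot s (excess u k) x y ≤ holderQuot s u x y) ∨
      (holderQuot s u x y ≤ holderQuot s (excess u k) x y ∧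
        holderQuot s (excess u k) x y ≤ 0) := by
  have hd : 0 ≤ ‖x - y‖ ^ s := by positivity
  unfold holderQuot excess
  rcases le_total (u y) (u x) with hxy | hxy
  · left
    constructor
    · refine div_nonneg ?_ hd
      have := max_le_max_right 0 (sub_le_sub_right hxy k)
      linarith
    · refine div_le_div_of_nonneg_right ?_ hd
      rcases max_cases (u x - k) 0 with ⟨h1, _⟩ | ⟨h1, _⟩ <;>
        rcases max_cases (u y - k) 0 with ⟨h2, _⟩ | ⟨h2, _⟩ <;> linarith
  · right
    constructor
    · refine div_le_div_of_nonneg_right ?_ hd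
      rcases max_cases (u x - k) 0 with ⟨h1, _⟩ | ⟨h1, _⟩ <;>
        rcases max_cases (u y - k) 0 with ⟨h2, _⟩ | ⟨h2, _⟩ <;> linarith
    · refine div_nonpos_of_nonpos_of_nonneg ?_ hd
      have := max_le_max_right 0 (sub_le_sub_right hxy k)
      linarith

theorem abs_holderQuot_excess_le (u : EuclideanSpace ℝ (Fin n) → ℝ) (k : ℝ)
    (x y : EuclideanSpace ℝ (Fin n)) :
    |holderQuot s (excess u k) x y| ≤ |holderQuot s u x y| := by
  rcases holderQuot_excess (s := s) u k x y with ⟨h1, h2⟩ | ⟨h1, h2⟩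
  · exact abs_le_abs_of_nonneg h1 h2
  · exact abs_le_abs_of_nonpos h2 h1

theorem aemeasurable_excess (hu : AEMeasurable u volume) (k : ℝ) :
    AEMeasurable (excess u k) volume :=
  (hu.sub_const k).max aemeasurable_const

/-- Makes the excess an admissible test function; `0 ≤ k` ensures that it vanishes outside `Ω`. -/
theorem MemW0.excess (h : IsYoungFunction G g) (hu : MemW0 s G Ω u) {k : ℝ} (hk : 0 ≤ k) :
    MemW0 s G Ω (excess u k) where
  aemeasurable := aemeasurable_excess hu.aemeasurable k
  modular_lt_top := by
    refine lt_of_le_of_lt (lintegral_mono fun x => ?_) hu.modular_lt_top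
    refine ENNReal.ofReal_le_ofReal (h.mono (abs_nonneg _) ?_)
    rw [abs_of_nonneg (excess_nonneg u k x)]
    exact excess_le_abs u hk x
  fracModular_lt_top := by
    refine lt_of_le_of_lt (lintegral_mono fun p => ?_) hu.fracModular_lt_top
    refine ENNReal.ofReal_le_ofReal (div_le_div_of_nonneg_right ?_ (by positivity))
    exact h.mono (abs_nonneg _) (abs_holderQuot_excess_le u k p.1 p.2)
  ae_eq_zero := by
    filter_upwards [hu.ae_eq_zero] with x hx hxΩ
    simp [FracOrlicz.excess, hx hxΩ, hk]

/-! ### The energy estimate. -/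

theorem pairing_integrand_eq (s : ℝ) (u v : EuclideanSpace ℝ (Fin n) → ℝ)
    (x y : EuclideanSpace ℝ (Fin n)) :
    g (holderQuot s u x y) * ((v x - v y) / ‖x - y‖ ^ ((n : ℝ) + s)) =
      g (holderQuot s u x y) * holderQuot s v x y / ‖x - y‖ ^ n := by
  rcases eq_or_ne x y with rfl | hxy
  · simp [holderQuot]
  have hd : 0 < ‖x - y‖ := norm_pos_iff.2 (sub_ne_zero.2 hxy)
  rw [Real.rpow_add hd, Real.rpow_natCast]
  simp only [holderQuot]
  field_simp

theorem aemeasurable_pairing_integrand (h : IsYoungFunction G g) (s : ℝ)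
    (hu : AEMeasurable u volume) (hv : AEMeasurable v volume) :
    AEMeasurable (fun p : EuclideanSpace ℝ (Fin n) × EuclideanSpace ℝ (Fin n) =>
      g (holderQuot s u p.1 p.2) * holderQuot s v p.1 p.2 / ‖p.1 - p.2‖ ^ n) volume := by
  have h2 : Measurable fun p : EuclideanSpace ℝ (Fin n) × EuclideanSpace ℝ (Fin n) =>
    ‖p.1 - p.2‖ ^ n := by fun_prop
  exact ((h.measurable_density.comp_aemeasurable (aemeasurable_holderQuot s hu)).mul
    (aemeasurable_holderQuot s hv)).div h2.aemeasurable

/-- Testing with the excess controls its fractional modular by the pairing. -/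
theorem fracModular_excess_le_pairing (h : IsYoungFunction G g) {p : ℝ}
    (hp : ∀ t, 0 < t → t * g t ≤ p * G t) (hu : MemW0 s G Ω u) (k : ℝ) :
    fracModular s G (excess u k) ≤
      ENNReal.ofReal (fracLaplacePairing s g u (excess u k)) := by
  set F := fun p : EuclideanSpace ℝ (Fin n) × EuclideanSpace ℝ (Fin n) =>
    g (holderQuot s u p.1 p.2) * holderQuot s (excess u k) p.1 p.2 / ‖p.1 - p.2‖ ^ n with hF
  have hpair : fracLaplacePairing s g u (excess u k) = ∫ p, F p := by
    simp only [fracLaplacePairing, pairing_integrand_eq, hF]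
  -- With `w` the excess, `G(|Dw|) ≤ g(Dw) Dw ≤ g(Du) Dw ≤ g(Du) Du ≤ p G(|Du|)`. The upper end
  -- gives integrability, without which the pairing would be the default value `0`.
  have hbound : ∀ x y, G |holderQuot s (excess u k) x y| ≤
        g (holderQuot s u x y) * holderQuot s (excess u k) x y ∧
      g (holderQuot s u x y) * holderQuot s (excess u k) x y ≤
        p * G |holderQuot s u x y| := by
    intro x y
    have h1 := h.abs_le_density_mul_self (holderQuot s (excess u k) x y)
    have h2 := h.density_mul_self_le hp (holderQuot s u x y)
    rcases holderQuot_excess (s := s) u k x y with ⟨ha, hb⟩ | ⟨ha, hb⟩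
    · have hg := h.density_monotone hb
      have hg0 := h.density_nonneg (ha.trans hb)
      constructor <;> nlinarith
    · have hg := h.density_monotone ha
      have hg0 := h.density_monotone (ha.trans hb)
      rw [h.density_zero] at hg0
      constructor <;> nlinarith
  have hlow : ∀ q, G |holderQuot s (excess u k) q.1 q.2| / ‖q.1 - q.2‖ ^ n ≤ F q := fun q =>
    div_le_div_of_nonneg_right (hbound q.1 q.2).1 (by positivity)
  have hF0 : ∀ q, 0 ≤ F q := fun q =>
    le_trans (div_nonneg (h.nonneg (abs_nonneg _)) (by positivity)) (hlow q)
  have hint : Integrable F volume := by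
    refine ⟨(aemeasurable_pairing_integrand h s hu.aemeasurable
      (aemeasurable_excess hu.aemeasurable k)).aestronglyMeasurable, ?_⟩
    rw [hasFiniteIntegral_iff_ofReal (ae_of_all _ hF0)]
    calc ∫⁻ q, ENNReal.ofReal (F q)
        ≤ ∫⁻ q : EuclideanSpace ℝ (Fin n) × EuclideanSpace ℝ (Fin n), ENNReal.ofReal p *
          ENNReal.ofReal (G |holderQuot s u q.1 q.2| / ‖q.1 - q.2‖ ^ n) := by
          refine lintegral_mono fun q => ?_
          rw [← ENNReal.ofReal_mul' (div_nonneg (h.nonneg (abs_nonneg _)) (by positivity)),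
            ← mul_div_assoc]
          exact ENNReal.ofReal_le_ofReal
            (div_le_div_of_nonneg_right (hbound q.1 q.2).2 (by positivity))
      _ = ENNReal.ofReal p * fracModular s G u :=
          lintegral_const_mul'' _ (aemeasurable_fracModular_integrand h s hu.aemeasurable)
      _ < ⊤ := ENNReal.mul_lt_top ENNReal.ofReal_lt_top hu.fracModular_lt_top
  rw [hpair, ofReal_integral_eq_lintegral_ofReal hint (ae_of_all _ hF0)]
  exact lintegral_mono fun q => ENNReal.ofReal_le_ofReal (hlow q)

/-- The energy estimate for the excess of a weak solution above two consecutive levels. -/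
theorem IsWeakSolution.fracModular_excess_le (h : IsYoungFunction G g) {p lam : ℝ} (hp0 : 0 ≤ p)
    (hp : ∀ t, 0 < t → t * g t ≤ p * G t) (hu : IsWeakSolution s G g lam Ω u)
    {k l m : ℝ} (hk : 0 ≤ k) (hkl : k ≤ l) (hm : 1 ≤ m) (hml : l ≤ m * (l - k)) :
    fracModular s G (excess u l) ≤
      ENNReal.ofReal (|lam| * (p * m ^ p)) * ∫⁻ x, ENNReal.ofReal (G |excess u k x|) := by
  have hl : 0 ≤ l := hk.trans hkl
  have hmp : 0 ≤ m ^ p := by positivity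
  have hpt : ∀ x, 0 ≤ g (u x) * excess u l x ∧
      g (u x) * excess u l x ≤ p * m ^ p * G |excess u k x| := by
    intro x
    have hG := h.nonneg (abs_nonneg (excess u k x))
    rcases le_or_gt (u x) l with hx | hx
    · have : excess u l x = 0 := max_eq_right (by linarith)
      rw [this, mul_zero]
      exact ⟨le_rfl, by positivity⟩
    · have hux : 0 ≤ u x := hl.trans hx.le
      have hel : excess u l x = u x - l := max_eq_left (by linarith)
      have hek : excess u k x = u x - k := max_eq_left (by linarith)
      have hg := h.density_nonneg hux
      refine ⟨mul_nonneg hg (excess_nonneg u l x), ?_⟩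
      calc g (u x) * excess u l x ≤ g (u x) * u x := by rw [hel]; gcongr; linarith
        _ ≤ p * G |u x| := h.density_mul_self_le hp _
        -- Since `u x > l` and `m ≥ 1`, `u x = l + (u x - l) ≤ m (l - k) + m (u x - l) = m (u x -
        -- k)`.
        _ ≤ p * G (m * |excess u k x|) := by
          gcongr
          apply h.mono (abs_nonneg _)
          rw [abs_of_nonneg hux, hek, abs_of_nonneg (by linarith)]
          nlinarith
        _ ≤ p * (m ^ p * G |excess u k x|) := by
          gcongr
          exact h.comp_mul_le hp hm (abs_nonneg _)
        _ = _ := by ring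
  have hmeas : AEMeasurable (fun x => ENNReal.ofReal (G |excess u k x|)) volume :=
    (h.continuous_comp_abs.measurable.comp_aemeasurable
      (aemeasurable_excess hu.memW0.aemeasurable k)).ennreal_ofReal
  have hI : ENNReal.ofReal (∫ x in Ω, g (u x) * excess u l x) ≤
      ENNReal.ofReal (p * m ^ p) * ∫⁻ x, ENNReal.ofReal (G |excess u k x|) := by
    rw [← lintegral_const_mul'' _ hmeas]
    refine le_trans ?_ (setLIntegral_le_lintegral Ω _)
    by_cases hint : Integrable (fun x => g (u x) * excess u l x) (volume.restrict Ω)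
    · rw [ofReal_integral_eq_lintegral_ofReal hint (ae_of_all _ fun x => (hpt x).1)]
      refine lintegral_mono fun x => ?_
      rw [← ENNReal.ofReal_mul (by positivity)]
      exact ENNReal.ofReal_le_ofReal (hpt x).2
    -- A non-integrable integrand has integral `0` by convention, and the bound is trivial.
    · rw [integral_undef hint]; simp
  have hI0 : 0 ≤ ∫ x in Ω, g (u x) * excess u l x := integral_nonneg fun x => (hpt x).1
  calc fracModular s G (excess u l)
      ≤ ENNReal.ofReal (fracLaplacePairing s g u (excess u l)) :=
        fracModular_excess_le_pairing h hp hu.memW0 l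
    _ ≤ ENNReal.ofReal (|lam| * ∫ x in Ω, g (u x) * excess u l x) := by
        rw [hu.weak_eq _ (hu.memW0.excess h hl)]
        exact ENNReal.ofReal_le_ofReal (mul_le_mul_of_nonneg_right (le_abs_self _) hI0)
    _ ≤ ENNReal.ofReal |lam| *
        (ENNReal.ofReal (p * m ^ p) * ∫⁻ x, ENNReal.ofReal (G |excess u k x|)) := by
        rw [ENNReal.ofReal_mul (abs_nonneg _)]
        gcongr
    _ = _ := by rw [← mul_assoc, ← ENNReal.ofReal_mul (abs_nonneg _)]

/-! ### The De Giorgi iteration. -/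

theorem lintegral_excess_anti (h : IsYoungFunction G g) {k l : ℝ} (hkl : k ≤ l) :
    ∫⁻ x, ENNReal.ofReal (G |excess u l x|) ≤ ∫⁻ x, ENNReal.ofReal (G |excess u k x|) := by
  refine lintegral_mono fun x => ENNReal.ofReal_le_ofReal (h.mono (abs_nonneg _) ?_)
  exact abs_le_abs_of_nonneg (excess_nonneg u l x) (max_le_max_right 0 (by linarith))

/-- Chebyshev's inequality: where `u > l`, the excess over `k` is at least `l - k`. -/
theorem volume_excess_ne_zero_le (h : IsYoungFunction G g) (hu : AEMeasurable u volume)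
    {k l : ℝ} (hkl : k < l) :
    ENNReal.ofReal (G (l - k)) * volume {x | excess u l x ≠ 0} ≤
      ∫⁻ x, ENNReal.ofReal (G |excess u k x|) := by
  have hmeas : AEMeasurable (fun x => ENNReal.ofReal (G |excess u k x|)) volume :=
    (h.continuous_comp_abs.measurable.comp_aemeasurable (aemeasurable_excess hu k)).ennreal_ofReal
  refine le_trans ?_ (mul_meas_ge_le_lintegral₀ hmeas (ENNReal.ofReal (G (l - k))))
  gcongr with x
  intro hx
  have hux : l < u x := by
    by_contra! hle
    exact hx (max_eq_right (by linarith))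
  refine ENNReal.ofReal_le_ofReal (h.mono (by linarith) ?_)
  rw [abs_of_nonneg (excess_nonneg u k x)]
  exact le_trans (by linarith) (le_max_left _ _)

theorem lintegral_excess_zero_le (h : IsYoungFunction G g) (hΩ : MeasurableSet Ω)
    (hu : MemW0 s G Ω u) :
    ∫⁻ x, ENNReal.ofReal (G |excess u 0 x|) ≤ modular G Ω u := by
  rw [modular, ← lintegral_indicator hΩ]
  refine lintegral_mono_ae ?_
  filter_upwards [hu.ae_eq_zero] with x hx
  by_cases hxΩ : x ∈ Ω
  · rw [indicator_of_mem hxΩ]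
    refine ENNReal.ofReal_le_ofReal (h.mono (abs_nonneg _) ?_)
    rw [abs_of_nonneg (excess_nonneg u 0 x)]
    exact excess_le_abs u le_rfl x
  · simp [excess, hx hxΩ, h.map_zero]

/-- One step of the De Giorgi iteration. -/
theorem IsWeakSolution.lintegral_excess_le (h : IsYoungFunction G g) (hs0 : 0 < s)
    {p lam : ℝ} (hp0 : 0 ≤ p) (hp : ∀ t, 0 < t → t * g t ≤ p * G t)
    (hu : IsWeakSolution s G g lam Ω u) {k l m r a : ℝ} (hk : 0 ≤ k) (hkl : k < l)
    (hm : 1 ≤ m) (hml : l ≤ m * (l - k)) (hr0 : 0 < r) (hr1 : r ≤ 1)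
    (hvol : a ≤ unitBallVolume n * r ^ n / 2 * G (l - k))
    (ha : ∫⁻ x, ENNReal.ofReal (G |excess u k x|) ≤ ENNReal.ofReal a) :
    ∫⁻ x, ENNReal.ofReal (G |excess u l x|) ≤
      ENNReal.ofReal (2 * r ^ s / unitBallVolume n * (|lam| * (p * m ^ p)) * a) := by
  have hω := unitBallVolume_pos n
  have hd : 0 < G (l - k) := h.pos (by linarith)
  have hmp : 0 ≤ m ^ p := by positivity
  have hV : volume {x | excess u l x ≠ 0} ≤ ENNReal.ofReal (unitBallVolume n * r ^ n / 2) := by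
    have h1 := (volume_excess_ne_zero_le h hu.memW0.aemeasurable hkl).trans
      (ha.trans (ENNReal.ofReal_le_ofReal hvol))
    rw [mul_comm (unitBallVolume n * r ^ n / 2), ENNReal.ofReal_mul hd.le] at h1
    exact (ENNReal.mul_le_mul_iff_right (ENNReal.ofReal_pos.2 hd).ne'
      ENNReal.ofReal_ne_top).1 h1
  calc ∫⁻ x, ENNReal.ofReal (G |excess u l x|)
      ≤ ENNReal.ofReal (2 * r ^ s / unitBallVolume n) * fracModular s G (excess u l) :=
        lintegral_le_mul_fracModular h hs0 (aemeasurable_excess hu.memW0.aemeasurable l)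
          hr0 hr1 hV
    _ ≤ ENNReal.ofReal (2 * r ^ s / unitBallVolume n) *
        (ENNReal.ofReal (|lam| * (p * m ^ p)) * ENNReal.ofReal a) := by
        gcongr
        refine (hu.fracModular_excess_le h hp0 hp hk hkl.le hm hml).trans ?_
        gcongr
    _ = _ := by
        rw [← mul_assoc, ← ENNReal.ofReal_mul (by positivity),
          ← ENNReal.ofReal_mul (by positivity)]

/-- The De Giorgi iteration: a weak solution is bounded above by `K` as soon as `K` is large
with respect to the modular of the solution. -/
theorem IsWeakSolution.ae_le (h : IsYoungFunction G g) (hG1 : G 1 = 1) (hs0 : 0 < s)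
    {p lam μ : ℝ} (hp0 : 0 < p) (hp : ∀ t, 0 < t → t * g t ≤ p * G t)
    (hΩ : MeasurableSet Ω) (hu : IsWeakSolution s G g lam Ω u)
    (hμ : modular G Ω u ≤ ENNReal.ofReal μ) (hμ0 : 0 ≤ μ) {b q ρ K : ℝ} (hb : b = 2 ^ p)
    (hq0 : 0 < q) (hq1 : q ≤ 1) (hq : q ^ s * b = 1) (hρ0 : 0 < ρ) (hρ1 : ρ ≤ 1)
    (hρ : 2 * ρ ^ s * (|lam| * (p * b)) ≤ unitBallVolume n * (q ^ n / b)) (hK1 : 1 ≤ K)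
    (hK : 2 * μ * b ≤ unitBallVolume n * ρ ^ n * K) :
    ∀ᵐ x, u x ≤ K := by
  have hω := unitBallVolume_pos n
  have hb1 : 1 < b := hb ▸ Real.one_lt_rpow (by norm_num) hp0
  have hb0 : 0 < b := by linarith
  have hK0 : 0 < K := by linarith
  -- The decay rate for which `τ ^ j * b ^ j` matches the volume factor `(q ^ j) ^ n` of the
  -- shrinking balls.
  set τ := q ^ n / b with hτ
  have hτ0 : 0 < τ := by positivity
  have hτ1 : τ < 1 := by
    rw [hτ, div_lt_one hb0]
    exact (pow_le_one₀ hq0.le hq1).trans_lt hb1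
  have hhalf : ∀ j : ℕ, (0 : ℝ) < (1 / 2) ^ j ∧ ((1 / 2 : ℝ)) ^ j ≤ 1 := fun j =>
    ⟨by positivity, pow_le_one₀ (by norm_num) (by norm_num)⟩
  have iter : ∀ j : ℕ, ∫⁻ x, ENNReal.ofReal (G |excess u (K * (1 - (1 / 2) ^ j)) x|) ≤
      ENNReal.ofReal (μ * τ ^ j) := by
    intro j
    induction j with
    | zero =>
      simp only [pow_zero, sub_self, mul_zero, mul_one]
      exact (lintegral_excess_zero_le h hΩ hu.memW0).trans hμ
    | succ j ih =>
      have hdiff : K * (1 - (1 / 2) ^ (j + 1)) - K * (1 - (1 / 2) ^ j) =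
          K * (1 / 2) ^ (j + 1) := by ring
      have hm : (1 : ℝ) ≤ 2 ^ (j + 1) := one_le_pow₀ (by norm_num)
      have hmK : (2 : ℝ) ^ (j + 1) * (K * (1 / 2) ^ (j + 1)) = K := by
        rw [mul_left_comm, ← mul_pow]; norm_num
      have hmp : ((2 : ℝ) ^ (j + 1)) ^ p = b ^ (j + 1) := by
        rw [hb, Real.rpow_pow_comm (by norm_num)]
      -- `K ≤ G K` by superlinearity and `G 1 = 1`; the growth bound then carries this down to the
      -- gap between levels.
      have hGd : K ≤ b ^ (j + 1) * G (K * (1 / 2) ^ (j + 1)) := by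
        have h1 := h.mul_le_comp_mul hK1 zero_le_one
        have h2 := h.comp_mul_le hp hm (t := K * (1 / 2) ^ (j + 1)) (by positivity)
        rw [hmK, hmp] at h2
        rw [hG1, mul_one] at h1
        linarith
      have hqj : (q ^ j) ^ s * b ^ j = 1 := by
        rw [← Real.rpow_pow_comm hq0.le, ← mul_pow, hq, one_pow]
      have hτb : τ ^ j * b ^ j = (q ^ j) ^ n := by
        rw [← mul_pow, hτ, div_mul_cancel₀ _ hb0.ne', pow_right_comm]
      -- `m` times the gap between levels is `K`, which exceeds every level; `r ^ s` contributes the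
      -- `(q ^ j) ^ s` that cancels `b ^ j`.
      have step := hu.lintegral_excess_le h hs0 hp0.le hp
        (k := K * (1 - (1 / 2) ^ j)) (l := K * (1 - (1 / 2) ^ (j + 1)))
        (m := 2 ^ (j + 1)) (r := ρ * q ^ j) (a := μ * τ ^ j)
        (mul_nonneg hK0.le (by linarith [hhalf j]))
        (by linarith [mul_pos hK0 (hhalf (j + 1)).1])
        hm (by
          rw [hdiff, hmK]
          linarith [mul_pos hK0 (hhalf (j + 1)).1])
        (by positivity)
        (mul_le_one₀ hρ1 (by positivity) (pow_le_one₀ hq0.le hq1))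
        (by
          rw [hdiff]
          refine le_of_mul_le_mul_right ?_ (pow_pos hb0 (j + 1))
          calc μ * τ ^ j * b ^ (j + 1) = (2 * μ * b) * (τ ^ j * b ^ j) / 2 := by ring
            _ ≤ (unitBallVolume n * ρ ^ n * K) * (τ ^ j * b ^ j) / 2 := by gcongr
            _ = unitBallVolume n * (ρ * q ^ j) ^ n / 2 * K := by rw [hτb, mul_pow]; ring
            _ ≤ unitBallVolume n * (ρ * q ^ j) ^ n / 2 *
                (b ^ (j + 1) * G (K * (1 / 2) ^ (j + 1))) := by gcongr
            _ = _ := by ring)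
        ih
      refine step.trans (ENNReal.ofReal_le_ofReal ?_)
      rw [hmp, Real.mul_rpow hρ0.le (by positivity)]
      calc 2 * (ρ ^ s * (q ^ j) ^ s) / unitBallVolume n * (|lam| * (p * b ^ (j + 1))) *
            (μ * τ ^ j)
          = 2 * ρ ^ s * (|lam| * (p * b)) / unitBallVolume n * ((q ^ j) ^ s * b ^ j) *
            (μ * τ ^ j) := by ring
        _ ≤ τ * 1 * (μ * τ ^ j) := by
          rw [hqj]
          gcongr
          rwa [div_le_iff₀ hω, mul_comm τ]
        _ = μ * τ ^ (j + 1) := by ring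
  have hmeas : AEMeasurable (fun x => ENNReal.ofReal (G |excess u K x|)) volume :=
    (h.continuous_comp_abs.measurable.comp_aemeasurable
      (aemeasurable_excess hu.memW0.aemeasurable K)).ennreal_ofReal
  have hlim : Tendsto (fun j : ℕ => ENNReal.ofReal (μ * τ ^ j)) atTop (𝓝 0) := by
    have := ((tendsto_pow_atTop_nhds_zero_of_lt_one hτ0.le hτ1).const_mul μ)
    rw [mul_zero] at this
    simpa using ENNReal.tendsto_ofReal this
  have hzero : ∫⁻ x, ENNReal.ofReal (G |excess u K x|) = 0 := by
    refine le_antisymm (ge_of_tendsto' hlim fun j => ?_) zero_le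
    refine (lintegral_excess_anti h ?_).trans (iter j)
    linarith [mul_pos hK0 (hhalf j).1]
  filter_upwards [(lintegral_eq_zero_iff' hmeas).1 hzero] with x hx
  by_contra! hlt
  have : 0 < excess u K x := lt_max_of_lt_left (by linarith)
  have hpos := h.pos (abs_pos.2 this.ne')
  exact absurd (ENNReal.ofReal_eq_zero.1 hx) (not_le.2 hpos)

/-! ### Sign symmetry and choice of constants. -/

theorem holderQuot_neg (s : ℝ) (u : EuclideanSpace ℝ (Fin n) → ℝ)
    (x y : EuclideanSpace ℝ (Fin n)) :
    holderQuot s (fun x => -u x) x y = -holderQuot s u x y := by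
  simp only [holderQuot]; ring

theorem modular_neg (G : ℝ → ℝ) (Ω : Set (EuclideanSpace ℝ (Fin n)))
    (u : EuclideanSpace ℝ (Fin n) → ℝ) : modular G Ω (fun x => -u x) = modular G Ω u := by
  simp only [modular, abs_neg]

theorem IsWeakSolution.neg (h : IsYoungFunction G g) {lam : ℝ}
    (hu : IsWeakSolution s G g lam Ω u) : IsWeakSolution s G g lam Ω fun x => -u x where
  memW0 :=
    { aemeasurable := hu.memW0.aemeasurable.neg
      modular_lt_top := by
        rw [modular_neg]; exact hu.memW0.modular_lt_top
      fracModular_lt_top := by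
        simpa only [fracModular, holderQuot_neg, abs_neg] using hu.memW0.fracModular_lt_top
      ae_eq_zero := by
        filter_upwards [hu.memW0.ae_eq_zero] with x hx hxΩ
        rw [hx hxΩ, neg_zero] }
  weak_eq v hv := by
    have := hu.weak_eq v hv
    simp only [fracLaplacePairing, holderQuot_neg, h.density_odd, neg_mul,
      integral_neg] at this ⊢
    rw [this, mul_neg]

/-- The order of choice matters: `q` cancels the growth of `b ^ j`, `ρ` then absorbs `|lam|`, and
`K` comes last. None of them sees `G`, `Ω` or `u`, so the final bound is uniform. -/
theorem exists_iteration_parameters (n : ℕ) {s p μ lam b : ℝ} (hs0 : 0 < s) (hp0 : 0 < p)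
    (hb : b = 2 ^ p) :
    ∃ q ρ K : ℝ, 0 < q ∧ q ≤ 1 ∧ q ^ s * b = 1 ∧ 0 < ρ ∧ ρ ≤ 1 ∧
      2 * ρ ^ s * (|lam| * (p * b)) ≤ unitBallVolume n * (q ^ n / b) ∧ 1 ≤ K ∧
      2 * μ * b ≤ unitBallVolume n * ρ ^ n * K := by
  have hω := unitBallVolume_pos n
  have hb1 : 1 < b := hb ▸ Real.one_lt_rpow (by norm_num) hp0
  have hb0 : 0 < b := by linarith
  have hroot : ∀ t : ℝ, 0 < t → t ≤ 1 → ∃ z : ℝ, 0 < z ∧ z ≤ 1 ∧ z ^ s = t := fun t ht ht1 =>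
    ⟨t ^ s⁻¹, by positivity, Real.rpow_le_one ht.le ht1 (by positivity),
      Real.rpow_inv_rpow ht.le hs0.ne'⟩
  obtain ⟨q, hq0, hq1, hq⟩ := hroot b⁻¹ (by positivity) (inv_le_one_of_one_le₀ hb1.le)
  set c := 2 * (|lam| * (p * b)) with hc
  have hc0 : 0 ≤ c := by positivity
  set A := unitBallVolume n * (q ^ n / b) with hA
  have hA0 : 0 < A := by positivity
  -- The denominator `c + 1` stays positive when `lam = 0`.
  obtain ⟨ρ, hρ0, hρ1, hρ⟩ := hroot (min 1 (A / (c + 1))) (by positivity) (min_le_left _ _)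
  refine ⟨q, ρ, max 1 (2 * μ * b / (unitBallVolume n * ρ ^ n)), hq0, hq1, ?_, hρ0, hρ1, ?_,
    le_max_left _ _, ?_⟩
  · rw [hq, inv_mul_cancel₀ hb0.ne']
  · calc 2 * ρ ^ s * (|lam| * (p * b)) = ρ ^ s * c := by rw [hc]; ring
      _ ≤ A / (c + 1) * (c + 1) := by
        rw [hρ]
        gcongr
        · exact min_le_right _ _
        · linarith
      _ = A := div_mul_cancel₀ _ (by positivity)
  · rw [← div_le_iff₀' (by positivity)]
    exact le_max_right _ _

end FracOrlicz

end

theorem theorem1p1 (n : ℕ) (s pm pp μ lam : ℝ)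
    (hs0 : 0 < s) (hs1 : s < 1) (hpm : 1 < pm) (hpp : pm < pp) (hsub : s * pp < n)
    (hμ : 0 < μ) :
    ∃ C₀ : ℝ, 0 < C₀ ∧
      ∀ G g : ℝ → ℝ, FracOrlicz.IsYoungFunction G g → G 1 = 1 →
        (∀ t : ℝ, 0 < t → pm ≤ t * g t / G t ∧ t * g t / G t ≤ pp) →
      ∀ Ω : Set (EuclideanSpace ℝ (Fin n)), IsOpen Ω → Bornology.IsBounded Ω →
      ∀ u : EuclideanSpace ℝ (Fin n) → ℝ,
        FracOrlicz.IsWeakSolution s G g lam Ω u →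
        FracOrlicz.modular G Ω u = ENNReal.ofReal μ →
        MemLp u ⊤ (volume.restrict Ω) ∧
          eLpNorm u ⊤ (volume.restrict Ω) ≤ ENNReal.ofReal C₀ := by
  have hpp0 : 0 < pp := by linarith
  obtain ⟨q, ρ, K, hq0, hq1, hq, hρ0, hρ1, hρ, hK1, hK⟩ :=
    FracOrlicz.exists_iteration_parameters n (μ := μ) (lam := lam) hs0 hpp0 rfl
  refine ⟨K, by linarith, fun G g h hG1 hgrowth Ω hΩ _ u hu hmod => ?_⟩
  have hp : ∀ t, 0 < t → t * g t ≤ pp * G t := fun t ht =>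
    (div_le_iff₀ (h.pos ht)).1 (hgrowth t ht).2
  have hupper := hu.ae_le h hG1 hs0 hpp0 hp hΩ.measurableSet hmod.le hμ.le rfl hq0 hq1 hq
    hρ0 hρ1 hρ hK1 hK
  have hlower := (hu.neg h).ae_le h hG1 hs0 hpp0 hp hΩ.measurableSet
    ((FracOrlicz.modular_neg G Ω u).trans hmod).le hμ.le rfl hq0 hq1 hq hρ0 hρ1 hρ hK1 hK
  have hbound : ∀ᵐ x ∂volume.restrict Ω, ‖u x‖ ≤ K := by
    refine ae_restrict_of_ae ?_
    filter_upwards [hupper, hlower] with x hx hx'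
    exact abs_le.2 ⟨by linarith, hx⟩
  refine ⟨memLp_top_of_bound hu.memW0.aemeasurable.restrict.aestronglyMeasurable K hbound, ?_⟩
  rw [eLpNorm_exponent_top]
  exact eLpNormEssSup_le_of_ae_bound hbound
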